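/- Graphs are finite and undirected; they may have multiple edges but no loops. A graph $G$ is matching-covered if every edge of $G$ lies in at least one perfect matching of $G$. A half-edge $2$-colouring $c$ of $G$ assigns to every pair $(e,w)$, where $e$ is an edge of $G$ and $w$ is an end of $e$, a colour $c(e,w)\in\{0,1\}$ ($0$ is blue, $1$ is red). An edge $e=\{u,v\}$ is monochromatic if $c(e,u)=c(e,v)$ and bichromatic otherwise. A W-state graph is a pair $(G,c)$, where $G$ is a matching-covered graph and $c$ is a half-edge $2$-colouring of $G$ in which every monochromatic edge is blue (no edge has two red halves), such that (i) every perfect matching of $G$ contains exactly one bichromatic edge, and (ii) for every vertex $v$ of $G$ there is an edge $e$ incident with $v$ such that $c(e,v)=1$. Corollary. No W-state graph is simple. Equivalently, every W-state graph contains at least one pair of parallel edges (two distinct edges with the same two ends). -/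

import Mathlib

namespace Graph

variable {α β : Type*}

/-- A half-edge of a multigraph `G`: a pair `(e, w)` where `w` is an end of the edge `e`. -/
abbrev HalfEdge (G : Graph α β) : Type _ := {h : β × α // G.Inc h.1 h.2}

/-- A half-edge `2`-colouring; the colour `0` is called blue and `1` is called red. -/
abbrev HalfEdgeColouring (G : Graph α β) : Type _ := G.HalfEdge → Fin 2

/-- A perfect matching of a (loopless) multigraph: a set of edges such that every vertex is an end
of exactly one of them. -/
structure IsPerfectMatching (G : Graph α β) (M : Set β) : Prop where
  subset_edgeSet : M ⊆ G.edgeSet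
  existsUnique_inc : ∀ v ∈ G.vertexSet, ∃! e, e ∈ M ∧ G.Inc e v

/-- Every edge lies in at least one perfect matching. -/
def IsMatchingCovered (G : Graph α β) : Prop :=
  ∀ e ∈ G.edgeSet, ∃ M, G.IsPerfectMatching M ∧ e ∈ M

namespace HalfEdgeColouring

variable {G : Graph α β}

/-- The set of monochromatic edges: both halves have the same colour. -/
def monochromaticEdges (c : G.HalfEdgeColouring) : Set β :=
  {e | e ∈ G.edgeSet ∧
    ∀ (u v : α) (h : G.IsLink e u v), c ⟨(e, u), h.inc_left⟩ = c ⟨(e, v), h.inc_right⟩}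

/-- The set of bichromatic edges: the edges that are not monochromatic. -/
def bichromaticEdges (c : G.HalfEdgeColouring) : Set β :=
  G.edgeSet \ c.monochromaticEdges

/-- All monochromatic edges are blue, that is, no edge has two red halves. -/
def MonochromaticAreBlue (c : G.HalfEdgeColouring) : Prop :=
  ∀ e ∈ c.monochromaticEdges, ∀ (w : α) (h : G.Inc e w), c ⟨(e, w), h⟩ = 0

/-- `(G, c)` is a W-state graph. -/
structure IsWState (c : G.HalfEdgeColouring) : Prop where
  matchingCovered : G.IsMatchingCovered
  monochromaticAreBlue : c.MonochromaticAreBlue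
  matching_condition : ∀ M, G.IsPerfectMatching M → (M ∩ c.bichromaticEdges).ncard = 1
  vertex_condition : ∀ v ∈ G.vertexSet, ∃ (e : β) (h : G.Inc e v), c ⟨(e, v), h⟩ = 1

end HalfEdgeColouring

end Graph

/-!
Choose at every vertex `v` an edge that is red at `v`, and let `f v` be its other end. These edges
are bichromatic, and if there are no parallel edges then `f (f v) ≠ v`. Let `H` be the graph of the
edges that are not bichromatic. The hypothesis on perfect matchings says that `H` has no perfect
matching, that `H` without `v` and `f v` has one for every `v`, and that `H` without the ends of
three disjoint edges `v – f v` has none. The contradiction comes from these three facts.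

All matching theory is contained in one exchange property, `Graph.Matchable.exchange`: two matchings
may be swapped along the alternating path that starts at a vertex covered by just one of them.

As in Gallai's lemma, it first shows (`Graph.exists_cut`) that the edges `v – f v` cross a cut
which no edge of `H` crosses. Each side of the cut is factor-critical in `H`. Call three vertices of
one side a good triple if that side without them has a perfect matching in `H`. Any two vertices
of a side lie in a good triple, by exchange four vertices of a side never contain exactly one
good triple, and two good triples on different sides are never joined by three disjoint edges
`v – f v`. On the other hand, iterating `f` gives a cycle of length at least four that
alternates between the sides, and `Graph.false_of_triples` derives a contradiction from it.
-/

namespace Graph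

/-! ### Perfectly matched vertex sets and the exchange property -/

section Matchable

variable {V : Type*} [DecidableEq V]

/-- `Matchable adj X` says that the finite set `X` can be partitioned into pairs of distinct
`adj`-related elements, i.e. that the graph `adj` induces on `X` a graph with a perfect matching. -/
inductive Matchable (adj : V → V → Prop) : Finset V → Prop
  | empty : Matchable adj ∅
  | insert {X : Finset V} {u v : V} (huv : adj u v) (hne : u ≠ v) (hu : u ∉ X) (hv : v ∉ X)
      (hX : Matchable adj X) : Matchable adj (insert u (insert v X))

namespace Matchable

variable {adj : V → V → Prop} {X Y : Finset V} {v : V}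

lemma even_card (h : Matchable adj X) : Even X.card := by
  induction h with
  | empty => simp
  | insert huv hne hu hv hX ih =>
    rw [Finset.card_insert_of_notMem (by simp [hne, hu]), Finset.card_insert_of_notMem hv]
    grind

/-- A matched element can be deleted together with its partner. -/
lemma exists_erase (hsymm : ∀ u v, adj u v → adj v u) (h : Matchable adj X) (hv : v ∈ X) :
    ∃ w ∈ X, w ≠ v ∧ adj v w ∧ Matchable adj (X \ {v, w}) := by
  induction h with
  | empty => simp at hv
  | @insert X a b hab hne ha hb hX ih =>
    by_cases hva : v = a
    · subst hva
      refine ⟨b, by simp, hne.symm, hab, ?_⟩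
      convert hX using 1
      grind
    by_cases hvb : v = b
    · subst hvb
      refine ⟨a, by simp, hne, hsymm _ _ hab, ?_⟩
      convert hX using 1
      grind
    obtain ⟨w, hw, hwv, hadj, hm⟩ := ih (by grind)
    refine ⟨w, by grind, hwv, hadj, ?_⟩
    convert Matchable.insert hab hne (by grind) (by grind) hm using 1
    grind

/-- Simultaneous exchange: follow the path starting at `v` that alternates between a matching of `X`
and a matching of `Y`, up to its other end `w`, and swap the two matchings along this path. -/
lemma exchange (hsymm : ∀ u v, adj u v → adj v u) (hX : Matchable adj X) (hY : Matchable adj Y)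
    (hvX : v ∈ X) (hvY : v ∉ Y) :
    ∃ w ∈ symmDiff X Y, w ≠ v ∧ Matchable adj (symmDiff X {v, w}) ∧
      Matchable adj (symmDiff Y {v, w}) := by
  induction hn : X.card using Nat.strong_induction_on generalizing X Y v with
  | _ n ih =>
  subst hn
  obtain ⟨v₁, hv₁, hne₁, hadj₁, hX₁⟩ := hX.exists_erase hsymm hvX
  -- The alternating path is `v, v₁, v₂, …`; it ends as soon as it leaves `Y` or `X`.
  by_cases hv₁Y : v₁ ∈ Y
  swap
  · clear ih
    refine ⟨v₁, by simp [Finset.mem_symmDiff, *], hne₁, ?_, ?_⟩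
    · convert hX₁ using 1
      ext z
      simp only [Finset.mem_symmDiff, Finset.mem_sdiff, Finset.mem_insert, Finset.mem_singleton]
      grind only
    · convert Matchable.insert hadj₁ hne₁.symm hvY hv₁Y hY using 1
      ext z
      simp only [Finset.mem_symmDiff, Finset.mem_insert, Finset.mem_singleton]
      grind only
  obtain ⟨v₂, hv₂, hne₂, hadj₂, hY₂⟩ := hY.exists_erase hsymm hv₁Y
  have hv₂v : v₂ ≠ v := fun h => hvY (h ▸ hv₂)
  by_cases hv₂X : v₂ ∈ X
  swap
  · clear ih
    refine ⟨v₂, by simp [Finset.mem_symmDiff, *], hv₂v, ?_, ?_⟩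
    · convert Matchable.insert hadj₂ hne₂.symm (by simp) (by simp [hv₂X]) hX₁ using 1
      ext z
      simp only [Finset.mem_symmDiff, Finset.mem_sdiff, Finset.mem_insert, Finset.mem_singleton]
      grind only
    · convert Matchable.insert hadj₁ hne₁.symm (by simp [hvY]) (by simp) hY₂ using 1
      ext z
      simp only [Finset.mem_symmDiff, Finset.mem_sdiff, Finset.mem_insert, Finset.mem_singleton]
      grind only
  -- Otherwise delete `v v₁` from the matching of `X` and `v₁ v₂` from that of `Y`, continue from
  -- `v₂`, and then add `v₁ v₂` and `v v₁` back, in exchanged roles.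
  obtain ⟨w, hw, hwv, hXw, hYw⟩ := ih (X \ {v, v₁}).card
    (Finset.card_lt_card (by
      refine Finset.ssubset_iff_subset_ne.2 ⟨Finset.sdiff_subset, fun h => ?_⟩
      rw [← h] at hvX
      simp at hvX)) hX₁ hY₂ (v := v₂) (by simp [*]) (by simp) rfl
  clear ih
  simp only [Finset.mem_symmDiff, Finset.mem_sdiff, Finset.mem_insert, Finset.mem_singleton] at hw
  have hwv' : w ≠ v := by grind only
  have hwv₁ : w ≠ v₁ := by grind only
  refine ⟨w, by simp only [Finset.mem_symmDiff]; grind only, hwv', ?_, ?_⟩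
  · convert Matchable.insert hadj₂ hne₂.symm
      (by simp [Finset.mem_symmDiff, hne₂.symm, hwv₁.symm]) (by simp [Finset.mem_symmDiff, *])
      hXw using 1
    ext z
    simp only [Finset.mem_symmDiff, Finset.mem_sdiff, Finset.mem_insert, Finset.mem_singleton]
    grind only
  · convert Matchable.insert hadj₁ hne₁.symm
      (by simp [Finset.mem_symmDiff, hvY, hv₂v.symm, hwv'.symm])
      (by simp [Finset.mem_symmDiff, hne₂.symm, hwv₁.symm]) hYw using 1
    ext z
    simp only [Finset.mem_symmDiff, Finset.mem_sdiff, Finset.mem_insert, Finset.mem_singleton]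
    grind only

lemma disjUnion (hX : Matchable adj X) (hY : Matchable adj Y) (hXY : Disjoint X Y) :
    Matchable adj (X ∪ Y) := by
  induction hX with
  | empty => simpa using hY
  | insert huv hne hu hv hX ih =>
    rw [Finset.insert_union, Finset.insert_union]
    rw [Finset.disjoint_insert_left, Finset.disjoint_insert_left] at hXY
    exact .insert huv hne (by grind) (by grind) (ih hXY.2.2)

lemma filter (hX : Matchable adj X) {p : V → Prop} [DecidablePred p]
    (hp : ∀ u v, adj u v → (p u ↔ p v)) : Matchable adj (X.filter p) := by
  induction hX with
  | empty => simpa using Matchable.empty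
  | @insert X u v huv hne hu hv hX ih =>
    by_cases h : p u
    · rw [Finset.filter_insert, if_pos h, Finset.filter_insert, if_pos ((hp _ _ huv).1 h)]
      exact .insert huv hne (by grind) (by grind) ih
    · rw [Finset.filter_insert, if_neg h, Finset.filter_insert,
        if_neg (fun h' => h ((hp _ _ huv).2 h'))]
      exact ih

/-- A perfect matching given by its partner function. -/
lemma of_involution {σ : V → V} (hσ : ∀ v ∈ X, σ v ∈ X ∧ adj v (σ v) ∧ σ (σ v) = v ∧ σ v ≠ v) :
    Matchable adj X := by
  induction hn : X.card using Nat.strong_induction_on generalizing X with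
  | _ n ih =>
  subst hn
  obtain rfl | ⟨v, hv⟩ := X.eq_empty_or_nonempty
  · exact .empty
  obtain ⟨h1, h2, h3, h4⟩ := hσ v hv
  have hX : X = Insert.insert v (Insert.insert (σ v) (X \ {v, σ v})) := by grind
  rw [hX]
  refine .insert h2 h4.symm (by simp) (by simp) (ih _ (Finset.card_lt_card ?_) ?_ rfl)
  · refine Finset.ssubset_iff_subset_ne.2 ⟨Finset.sdiff_subset, fun h => ?_⟩
    rw [← h] at hv
    simp at hv
  · intro u hu
    obtain ⟨k1, k2, k3, k4⟩ := hσ u (by grind)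
    refine ⟨?_, k2, k3, k4⟩
    grind

end Matchable

end Matchable

/-! ### Good triples on the two sides of a cut -/

section Triples

/-- The combinatorial heart of the argument. The elements of `V` are divided into two sides, and
each `v` is joined to an element `f v` of the other side, with `f (f v) ≠ v`. The relation `T` is a
symmetric ternary relation within the sides ("good triples") such that any two elements of a side
lie in a good triple (`hext`), a set of four elements of a side never contains exactly one good
triple (`hexch`), and no good triple is joined, element by element, to another one (`hrule`).

Such a configuration does not exist on a finite nonempty set: `f` has a cycle, and the members of
the cycle on one side form no good triple of the kind `b, f (f b), c` (`hiso`). Hence for fixed `y'`,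
not forming a good triple with `y'` behaves like an equivalence relation along the cycle; a
good triple `y', b 0, b 1` gives one jump, so there is a second jump `y', b l, b (l + 1)`. A good
triple `f (b 0), f (b l), x` then contradicts `hexch`. -/
theorem false_of_triples {V : Type*} [Finite V] [Nonempty V] (f : V → V) (side : V → Prop)
    (T : V → V → V → Prop)
    (hside : ∀ v, side (f v) ↔ ¬ side v)
    (hff : ∀ v, f (f v) ≠ v)
    (hrot : ∀ p q r, T p q r → T q r p) (hswap : ∀ p q r, T p q r → T q p r)
    (hne : ∀ p r, ¬ T p p r)
    (hTside : ∀ p q r, T p q r → (side p ↔ side r))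
    (hext : ∀ p q, p ≠ q → (side p ↔ side q) → ∃ r, T p q r)
    (hexch : ∀ p q r s, T p q r → (side s ↔ side p) → T s q r ∨ T p s r ∨ T p q s)
    (hrule : ∀ p q r p' q' r', (f p = p' ∨ f p' = p) → (f q = q' ∨ f q' = q) →
      (f r = r' ∨ f r' = r) → T p q r → ¬ T p' q' r') : False := by
  have hside2 : ∀ v, side (f (f v)) ↔ side v := fun v => by rw [hside, hside, not_not]
  -- The edges `f b – b`, `f b – f (f b)`, `f c – c`, `f c – f (f c)` and `x – f x` are combined in
  -- all four ways; `hexch` turns the four resulting bad triples into the implication.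
  have hbad_step : ∀ b c, (side b ↔ side c) → ¬ T b (f (f b)) c → ¬ T b (f (f b)) (f (f c)) := by
    intro b c hbc hb h
    by_cases hf : f b = f c
    · rw [← hf] at h
      exact hne _ _ (hrot _ _ _ h)
    obtain ⟨x, hx⟩ := hext _ _ hf (by rw [hside, hside, hbc])
    have hxb : side (f x) ↔ side b := by
      rw [hside, ← hTside _ _ _ hx, hside, not_not]
    have hxs : T b (f (f b)) (f x) := by
      rcases hexch _ _ _ (f x) h hxb with h | h | h
      · exact absurd (hrot _ _ _ h)
          (hrule _ _ _ _ _ _ (.inl rfl) (.inl rfl) (.inl rfl) hx)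
      · exact absurd (hrot _ _ _ (hswap _ _ _ h)) (fun h => hrule _ _ _ _ _ _ (.inr rfl) (.inl rfl)
          (.inl rfl) hx h)
      · exact h
    rcases hexch _ _ _ c hxs hbc.symm with h | h | h
    · exact hrule _ _ _ _ _ _ (.inl rfl) (.inr rfl) (.inl rfl) hx (hswap _ _ _ h)
    · exact hrule _ _ _ _ _ _ (.inr rfl) (.inr rfl) (.inl rfl) hx h
    · exact hb h
  -- By finiteness `f ∘ f` has a periodic point `b₀`; `b` enumerates its orbit.
  set g : V → V := f ∘ f with hg
  obtain ⟨b₀, k, hk, hper⟩ : ∃ b k, 0 < k ∧ g^[k] b = b := by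
    obtain ⟨v⟩ := ‹Nonempty V›
    obtain ⟨m, n, hmn, heq⟩ : ∃ m n, m < n ∧ g^[m] v = g^[n] v := by
      obtain ⟨m, n, hne, heq⟩ := Finite.exists_ne_map_eq_of_infinite (fun n => g^[n] v)
      rcases lt_or_gt_of_ne hne with h | h
      exacts [⟨m, n, h, heq⟩, ⟨n, m, h, heq.symm⟩]
    refine ⟨g^[m] v, n - m, by omega, ?_⟩
    rw [← Function.iterate_add_apply, Nat.sub_add_cancel hmn.le, heq]
  obtain ⟨b, hb0, hbs⟩ : ∃ b : ℕ → V, b 0 = b₀ ∧ ∀ n, b (n + 1) = f (f (b n)) :=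
    ⟨fun n => g^[n] b₀, rfl, fun n => Function.iterate_succ_apply' g n b₀⟩
  have hbk : ∀ j, b (j + k) = b j := by
    have key : ∀ n, b n = g^[n] b₀ := by
      intro n
      induction n with
      | zero => exact hb0
      | succ n ih => rw [hbs, Function.iterate_succ_apply', ih, hg, Function.comp]
    intro j
    rw [key, key, Function.iterate_add_apply, hper]
  have hbside : ∀ n, side (b n) ↔ side (b 0) := by
    intro n
    induction n with
    | zero => rfl
    | succ n ih => rw [hbs, hside2, ih]
  have hiso : ∀ i j, ¬ T (b i) (b (i + 1)) (b j) := by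
    intro i j
    have h1 : ∀ n, ¬ T (b i) (b (i + 1)) (b (i + 1 + n)) := by
      intro n
      induction n with
      | zero => exact fun h => hne _ _ (hrot _ _ _ h)
      | succ n ih =>
        rw [← add_assoc, hbs (i + 1 + n), hbs i]
        rw [hbs i] at ih
        exact hbad_step _ _ (by rw [hbside, hbside (i + 1 + n)]) ih
    -- By periodicity, `j` may be replaced by an index beyond `i + 1`.
    have h2 : ∀ m, b (j + k * m) = b j := by
      intro m
      induction m with
      | zero => rfl
      | succ m ih => rw [Nat.mul_succ, ← add_assoc, hbk, ih]
    have h3 : i + 1 ≤ j + k * (i + 1) := by nlinarith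
    obtain ⟨n, hn⟩ := Nat.exists_eq_add_of_le h3
    rw [← h2 (i + 1), hn]
    exact h1 n
  obtain ⟨y', hy'⟩ := hext (b 0) (b 1) (by rw [hbs]; exact (hff _).symm) (hbside 1).symm
  have hy's : side y' ↔ side (b 0) := (hTside _ _ _ hy').symm
  -- If `b 0, b 1` were the only jump of `y'`, then `y', b 1, b n` would be a bad triple for every
  -- `n ≥ 1`, in particular for `n = k`, where `b k = b 0`.
  obtain ⟨l, hl, hyl⟩ : ∃ l, f (b 0) ≠ f (b l) ∧ T y' (b l) (b (l + 1)) := by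
    by_contra! hcon
    have h1 : ∀ n, ¬ T y' (b 1) (b (n + 1)) := by
      intro n
      induction n with
      | zero => exact fun h => hne _ _ (hrot _ _ _ h)
      | succ n ih =>
        intro h
        by_cases hf : f (b 0) = f (b (n + 1))
        · rw [hbs (n + 1), ← hf, ← hbs 0] at h
          exact hne _ _ (hrot _ _ _ h)
        rcases hexch _ _ _ (b (n + 1)) h (by rw [hbside, hy's]) with h | h | h
        · exact hiso (n + 1) 1 (hswap _ _ _ (hrot _ _ _ (hrot _ _ _ h)))
        · exact hcon _ hf h
        · exact ih h
    obtain ⟨n, rfl⟩ := Nat.exists_eq_succ_of_ne_zero hk.ne'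
    apply h1 n
    have := hbk 0
    rw [zero_add] at this
    rw [this]
    exact hrot _ _ _ (hrot _ _ _ (hswap _ _ _ (hy')))
  -- Every `x` that separates the positions of the two jumps is joined only to elements without
  -- a jump there.
  have hsep : ∀ x y, (f x = y ∨ f y = x) → T (f (b 0)) (f (b l)) x →
      ¬ T y (b 0) (b 1) ∧ ¬ T y (b l) (b (l + 1)) := by
    intro x y hxy hx
    have hy : side y ↔ side (b 0) := by
      have h1 : side y ↔ ¬ side x := by
        rcases hxy with rfl | rfl
        · exact hside x
        · rw [hside, not_not]
      rw [h1, ← hTside _ _ _ hx, hside, not_not]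
    have link : ∀ n, f (f (b n)) = b (n + 1) := fun n => (hbs n).symm
    refine ⟨fun h => ?_, fun h => ?_⟩
    · rcases hexch _ _ _ (b l) h (by rw [hbside, hy]) with h | h | h
      · exact hiso 0 l (hrot _ _ _ h)
      · exact hrule _ _ _ _ _ _ (.inl (link 0)) (.inr rfl) hxy hx
          (hrot _ _ _ (hrot _ _ _ (hswap _ _ _ h)))
      · exact hrule _ _ _ _ _ _ (.inr rfl) (.inr rfl) hxy hx (hrot _ _ _ h)
    · rcases hexch _ _ _ (b 0) h hy.symm with h | h | h
      · exact hiso l 0 (hrot _ _ _ h)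
      · exact hrule _ _ _ _ _ _ (.inr rfl) (.inl (link l)) hxy hx (hrot _ _ _ h)
      · exact hrule _ _ _ _ _ _ (.inr rfl) (.inr rfl) hxy hx
          (hrot _ _ _ (hrot _ _ _ (hswap _ _ _ h)))
  obtain ⟨x, hx⟩ := hext _ _ hl (by rw [hside, hside, hbside l])
  obtain ⟨h0, hl'⟩ := hsep x (f x) (.inl rfl) hx
  have hys : side (f x) ↔ side (b 0) := by
    rw [hside, ← hTside _ _ _ hx, hside, not_not]
  have hjump : ∀ n, T y' (b n) (b (n + 1)) → ¬ T (f x) (b n) (b (n + 1)) →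
      ¬ T (f y') x (f (b n)) := by
    intro n h hn hT
    rcases hexch _ _ _ (f x) h (by rw [hys, hy's]) with h | h | h
    · exact hn h
    · exact hrule _ _ _ _ _ _ (.inr rfl) (.inl rfl) (.inl (hbs n).symm) hT h
    · exact hrule _ _ _ _ _ _ (.inr rfl) (.inl rfl) (.inr rfl) hT
        (hswap _ _ _ (hrot _ _ _ (hrot _ _ _ h)))
  rcases hexch _ _ _ (f y') hx (by rw [hside, hside, hy's]) with h | h | h
  · exact hjump l hyl hl' (hswap _ _ _ (hrot _ _ _ (hrot _ _ _ h)))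
  · exact hjump 0 (hrot _ _ _ (hrot _ _ _ hy')) h0 (hrot _ _ _ h)
  · exact (hsep _ _ (.inr rfl) h).1 (hrot _ _ _ (hrot _ _ _ hy'))

end Triples

/-! ### The removed edges form a cut -/

section Cut

variable {V : Type*} [Fintype V] [DecidableEq V] {adj : V → V → Prop} {f : V → V}

/-- Suppose that `V` is not matchable, but that it becomes so on removing `v` and `f v`, for any `v`.
Then the sides are the classes of the relation "`V` without `u, v` is not matchable". This is the
argument of Gallai's lemma: by exchange, the class of `v₀` is closed under adjacency and
contains at most one of `v`, `f v`; by parity it contains at least one of them. -/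
lemma exists_cut [Nonempty V] (hsymm : ∀ u v, adj u v → adj v u) (hirr : ∀ v, ¬ adj v v)
    (hne : ∀ v, f v ≠ v)
    (h0 : ¬ Matchable adj Finset.univ) (h1 : ∀ v, Matchable adj ({v, f v} : Finset V)ᶜ) :
    ∃ side : V → Prop, (∀ u v, adj u v → (side u ↔ side v)) ∧ ∀ v, side (f v) ↔ ¬ side v := by
  classical
  obtain ⟨v₀⟩ := ‹Nonempty V›
  have hadd : ∀ u v, u ≠ v → adj u v → ¬ Matchable adj ({u, v} : Finset V)ᶜ := by
    intro u v huv hadj h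
    apply h0
    convert Matchable.insert hadj huv (by simp) (by simp) h using 1
    ext z
    simp only [Finset.mem_univ, Finset.mem_insert, Finset.mem_compl, Finset.mem_singleton]
    tauto
  have heven : Even (Fintype.card V) := by
    have h := (h1 v₀).even_card
    have hc := Finset.card_add_card_compl ({v₀, f v₀} : Finset V)
    rw [Finset.card_pair (hne v₀).symm] at hc
    grind
  have hv₀ : ¬ Matchable adj ({v₀, v₀} : Finset V)ᶜ := by
    intro h
    have h := h.even_card
    have hc := Finset.card_add_card_compl ({v₀, v₀} : Finset V)
    simp only [Finset.pair_eq_singleton, Finset.card_singleton] at hc h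
    grind
  have hstep : ∀ u w, adj u w → ¬ Matchable adj ({u, v₀} : Finset V)ᶜ →
      ¬ Matchable adj ({w, v₀} : Finset V)ᶜ := by
    intro u w hadj hu hw
    have huw : u ≠ w := fun h => hirr w (h ▸ hadj)
    by_cases huv : u = v₀
    · subst huv
      exact hadd _ _ huw.symm (hsymm _ _ hadj) hw
    obtain ⟨t, ht, htu, hX, hY⟩ := hw.exchange hsymm (h1 u) (v := u) (by simp [*]) (by simp)
    have ht' : t = w ∨ t = v₀ ∨ t = f u := by
      simp only [Finset.mem_symmDiff, Finset.mem_compl, Finset.mem_insert,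
        Finset.mem_singleton] at ht
      tauto
    rcases ht' with rfl | rfl | rfl
    · apply hu
      convert hX using 1
      ext z
      simp only [Finset.mem_symmDiff, Finset.mem_compl, Finset.mem_insert,
        Finset.mem_singleton]
      grind only
    · apply hadd u w huw hadj
      convert hX using 1
      ext z
      simp only [Finset.mem_symmDiff, Finset.mem_compl, Finset.mem_insert,
        Finset.mem_singleton]
      grind only
    · apply h0
      convert hY using 1
      ext z
      simp only [Finset.mem_symmDiff, Finset.mem_compl, Finset.mem_insert,
        Finset.mem_singleton, Finset.mem_univ]
      tauto
  have hside : ∀ u v, adj u v →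
      (¬ Matchable adj ({u, v₀} : Finset V)ᶜ ↔ ¬ Matchable adj ({v, v₀} : Finset V)ᶜ) :=
    fun u v h => ⟨hstep u v h, hstep v u (hsymm _ _ h)⟩
  refine ⟨fun v => ¬ Matchable adj ({v, v₀} : Finset V)ᶜ, hside, fun v => ⟨fun hfv hv => ?_, ?_⟩⟩
  · have hv₁ : v₀ ≠ v := by
      rintro rfl
      apply hfv
      rw [Finset.pair_comm]
      exact h1 v₀
    have hv₂ : v₀ ≠ f v := by
      intro h
      apply hv
      rw [h]
      exact h1 v
    obtain ⟨t, ht, htu, hX, hY⟩ := (h1 v).exchange hsymm (h1 v₀) (v := v₀) (by simp [*]) (by simp)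
    have ht' : t = v ∨ t = f v ∨ t = f v₀ := by
      simp only [Finset.mem_symmDiff, Finset.mem_compl, Finset.mem_insert,
        Finset.mem_singleton] at ht
      tauto
    rcases ht' with rfl | rfl | rfl
    · apply hfv
      convert hX using 1
      ext z
      simp only [Finset.mem_symmDiff, Finset.mem_compl, Finset.mem_insert,
        Finset.mem_singleton]
      grind only
    · apply hv
      convert hX using 1
      ext z
      simp only [Finset.mem_symmDiff, Finset.mem_compl, Finset.mem_insert,
        Finset.mem_singleton]
      grind only
    · apply h0
      convert hY using 1
      ext z
      simp only [Finset.mem_symmDiff, Finset.mem_compl, Finset.mem_insert,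
        Finset.mem_singleton, Finset.mem_univ]
      tauto
  · intro hv hfv
    -- Otherwise the class `C` of `v₀` would be of even size, and also after deletion of `v₀`.
    set C : Finset V := Finset.univ.filter fun v => ¬ Matchable adj ({v, v₀} : Finset V)ᶜ with hC
    have e1 : Even C.card := by
      have := ((h1 v).filter hside).even_card
      convert this using 2
      ext z
      simp only [hC, Finset.mem_filter, Finset.mem_compl, Finset.mem_insert,
        Finset.mem_singleton, Finset.mem_univ]
      grind only
    have e2 : Even (C.erase v₀).card := by
      have := ((h1 v₀).filter hside).even_card
      have hf₀ : Matchable adj ({f v₀, v₀} : Finset V)ᶜ := by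
        rw [Finset.pair_comm]; exact h1 v₀
      convert this using 2
      ext z
      simp only [hC, Finset.mem_filter, Finset.mem_compl, Finset.mem_insert, Finset.mem_erase,
        Finset.mem_singleton, Finset.mem_univ]
      grind only
    have hmem : v₀ ∈ C := by simpa [hC] using hv₀
    have := Finset.card_erase_add_one hmem
    grind

/-- If `V` is not matchable, but becomes so on removing any pair `v, f v`, and never on
removing three disjoint such pairs, then `f (f v) = v` for some `v`. The good triples of
`false_of_triples` are those whose removal leaves their side of the cut matchable. -/
theorem false_of_matchable [Nonempty V] (hsymm : ∀ u v, adj u v → adj v u) (hirr : ∀ v, ¬ adj v v)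
    (hne : ∀ v, f v ≠ v) (hff : ∀ v, f (f v) ≠ v)
    (h0 : ¬ Matchable adj Finset.univ) (h1 : ∀ v, Matchable adj ({v, f v} : Finset V)ᶜ)
    (h3 : ∀ p q r p' q' r', (f p = p' ∨ f p' = p) → (f q = q' ∨ f q' = q) →
      (f r = r' ∨ f r' = r) → [p, q, r, p', q', r'].Nodup →
      ¬ Matchable adj ({p, q, r, p', q', r'} : Finset V)ᶜ) : False := by
  classical
  obtain ⟨side, hadj, hside⟩ := exists_cut hsymm hirr hne h0 h1
  let S : V → Finset V := fun v => Finset.univ.filter fun w => (side w ↔ side v)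
  have hS : ∀ v w, w ∈ S v ↔ (side w ↔ side v) := fun v w => by simp [S]
  have hScongr : ∀ v w, (side v ↔ side w) → S v = S w := fun v w h => by
    ext z; rw [hS, hS, h]
  -- `S v` is the side of `v`; it becomes matchable on removing any one of its elements.
  have hSerase : ∀ v, Matchable adj (S v \ {v}) := by
    intro v
    have := (h1 v).filter (p := fun w => (side w ↔ side v)) (fun u w h => by rw [hadj u w h])
    convert this using 1
    ext z
    have := hside v
    simp only [hS, Finset.mem_sdiff, Finset.mem_filter, Finset.mem_compl, Finset.mem_insert,
      Finset.mem_singleton]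
    grind only
  let T : V → V → V → Prop := fun p q r => p ≠ q ∧ q ≠ r ∧ p ≠ r ∧ (side p ↔ side q) ∧
    (side p ↔ side r) ∧ Matchable adj (S p \ {p, q, r})
  refine false_of_triples f side T hside hff ?_ ?_ ?_ ?_ ?_ ?_ ?_
  · rintro p q r ⟨hpq, hqr, hpr, sq, sr, h⟩
    refine ⟨hqr, hpr.symm, hpq.symm, sq.symm.trans sr, sq.symm, ?_⟩
    rw [← hScongr p q sq]
    convert h using 2
    ext z
    simp only [Finset.mem_insert, Finset.mem_singleton]
    tauto
  · rintro p q r ⟨hpq, hqr, hpr, sq, sr, h⟩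
    refine ⟨hpq.symm, hpr, hqr, sq.symm, sq.symm.trans sr, ?_⟩
    rw [← hScongr p q sq, Finset.insert_comm]
    exact h
  · rintro p r ⟨h, -⟩
    exact h rfl
  · rintro p q r ⟨-, -, -, -, sr, -⟩
    exact sr
  · intro p q hpq hs
    obtain ⟨r, hr, hrq, -, h⟩ := (hSerase p).exists_erase hsymm (v := q) (by
      simp [hS, hs, hpq.symm])
    simp only [Finset.mem_sdiff, Finset.mem_singleton, hS] at hr
    refine ⟨r, hpq, hrq.symm, fun h => hr.2 h.symm, hs, hr.1.symm, ?_⟩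
    convert h using 1
    ext z
    simp only [Finset.mem_sdiff, Finset.mem_insert, Finset.mem_singleton]
    tauto
  · rintro p q r s ⟨hpq, hqr, hpr, sq, sr, h⟩ hs
    by_cases hsp : s = p
    · subst hsp
      exact .inl ⟨hpq, hqr, hpr, sq, sr, h⟩
    by_cases hsq : s = q
    · subst hsq
      exact .inr (.inl ⟨hpq, hqr, hpr, sq, sr, h⟩)
    by_cases hsr : s = r
    · subst hsr
      exact .inr (.inr ⟨hpq, hqr, hpr, sq, sr, h⟩)
    obtain ⟨t, ht, hts, hX, -⟩ := h.exchange hsymm (hSerase s) (v := s) (by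
      simp [*]) (by simp)
    rw [hScongr s p hs] at ht
    have ht' : t = p ∨ t = q ∨ t = r := by
      simp only [Finset.mem_symmDiff, Finset.mem_sdiff, Finset.mem_insert,
        Finset.mem_singleton] at ht
      tauto
    have hmem : ∀ u, u = p ∨ u = q ∨ u = r ∨ u = s → u ∈ S p := by
      rintro u (rfl | rfl | rfl | rfl) <;> simp only [hS, hs, ← sq, ← sr]
    have m1 := hmem p; have m2 := hmem q; have m3 := hmem r; have m4 := hmem s
    rcases ht' with rfl | rfl | rfl
    · refine .inl ⟨hsq, hqr, hsr, hs.trans sq, hs.trans sr, ?_⟩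
      rw [hScongr s t hs]
      convert hX using 1
      ext z
      simp only [Finset.mem_symmDiff, Finset.mem_sdiff, Finset.mem_insert,
        Finset.mem_singleton]
      grind only
    · refine .inr (.inl ⟨Ne.symm hsp, hsr, hpr, hs.symm, sr, ?_⟩)
      convert hX using 1
      ext z
      simp only [Finset.mem_symmDiff, Finset.mem_sdiff, Finset.mem_insert,
        Finset.mem_singleton]
      grind only
    · refine .inr (.inr ⟨hpq, Ne.symm hsq, Ne.symm hsp, sq, hs.symm, ?_⟩)
      convert hX using 1
      ext z
      simp only [Finset.mem_symmDiff, Finset.mem_sdiff, Finset.mem_insert,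
        Finset.mem_singleton]
      grind only
  · rintro p q r p' q' r' hp hq hr ⟨hpq, hqr, hpr, sq, sr, h⟩ ⟨hpq', hqr', hpr', sq', sr', h'⟩
    have hlink : ∀ p p', (f p = p' ∨ f p' = p) → (side p' ↔ ¬ side p) := by
      rintro p p' (rfl | rfl)
      · exact hside p
      · rw [hside, not_not]
    have sp := hlink _ _ hp
    have hcross : ∀ a b, (side p ↔ side a) → (side p' ↔ side b) → a ≠ b := by
      rintro a b ha hb rfl
      exact iff_not_self (hb.symm.trans (sp.trans (not_congr ha)))
    refine h3 p q r p' q' r' hp hq hr ?_ ?_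
    · simp only [List.nodup_cons, List.mem_cons, List.not_mem_nil, or_false, not_or,
        not_false_eq_true, List.nodup_nil, and_true]
      refine ⟨⟨hpq, hpr, ?_, ?_, ?_⟩, ⟨hqr, ?_, ?_, ?_⟩, ⟨?_, ?_, ?_⟩, ⟨hpq', hpr'⟩, hqr'⟩ <;>
      · apply hcross <;> first | assumption | rfl
    · convert h.disjUnion h' ?_ using 1
      · ext z
        simp only [Finset.mem_compl, Finset.mem_union, Finset.mem_sdiff, Finset.mem_insert,
          Finset.mem_singleton, hS]
        by_cases hz : side p ↔ side z
        · have n1 := hcross z p' hz Iff.rfl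
          have n2 := hcross z q' hz sq'
          have n3 := hcross z r' hz sr'
          have n4 : ¬ (side z ↔ side p') := fun h => hcross z z hz h.symm rfl
          simp only [n1, n2, n3, n4, hz, or_false, false_and, true_and]
        · have hz' : side p' ↔ side z := sp.trans (not_iff.1 hz)
          have n1 := (hcross p z Iff.rfl hz').symm
          have n2 := (hcross q z sq hz').symm
          have n3 := (hcross r z sr hz').symm
          have n4 : ¬ (side z ↔ side p) := fun h => hz h.symm
          simp only [n1, n2, n3, n4, hz', false_or, false_and, true_and]
      · rw [Finset.disjoint_left]
        intro z hz hz'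
        simp only [Finset.mem_sdiff, hS] at hz hz'
        exact hcross z z hz.1.symm hz'.1.symm rfl

end Cut

/-! ### Perfect matchings of multigraphs -/

section PerfectMatching

variable {α β : Type*} {G : Graph α β} {B M N : Set β} {X : Finset G.vertexSet}

/-- Adjacency of vertices through an edge that does not belong to `B`. -/
def AdjAvoiding (G : Graph α β) (B : Set β) (u v : G.vertexSet) : Prop :=
  ∃ e, G.IsLink e u v ∧ e ∉ B

/-- The edges in `N` form a matching of `G` that covers precisely the vertices in `X` (for a
loopless `G`). -/
def MatchesOn (G : Graph α β) (N : Set β) (X : Finset G.vertexSet) : Prop :=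
  N ⊆ G.edgeSet ∧ (∀ v ∈ X, ∃! e, e ∈ N ∧ G.Inc e v) ∧ ∀ v ∉ X, ∀ e ∈ N, ¬ G.Inc e v

lemma MatchesOn.insert [DecidableEq G.vertexSet] (h : G.MatchesOn N X) {e : β}
    {u v : G.vertexSet} (he : G.IsLink e u v) (hu : u ∉ X) (hv : v ∉ X) :
    G.MatchesOn (insert e N) (insert u (insert v X)) := by
  obtain ⟨hN, hX, hX'⟩ := h
  have hinc : ∀ w : G.vertexSet, G.Inc e w → w = u ∨ w = v := fun w hw =>
    (hw.eq_or_eq_of_isLink he).imp Subtype.ext Subtype.ext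
  have hends : ∀ w : G.vertexSet, w ∉ X → G.Inc e w →
      ∃! f, f ∈ Insert.insert e N ∧ G.Inc f w := by
    intro w hw hew
    refine ⟨e, ⟨by simp, hew⟩, ?_⟩
    rintro f ⟨rfl | hf, hfw⟩
    · rfl
    · exact absurd hfw (hX' w hw f hf)
  refine ⟨Set.insert_subset he.edge_mem hN, fun w hw => ?_, fun w hw f hf hfw => ?_⟩
  · rw [Finset.mem_insert, Finset.mem_insert] at hw
    rcases hw with rfl | rfl | hw
    · exact hends w hu he.inc_left
    · exact hends w hv he.inc_right
    · obtain ⟨f, ⟨hf, hfw⟩, huniq⟩ := hX w hw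
      refine ⟨f, ⟨.inr hf, hfw⟩, ?_⟩
      rintro f' ⟨rfl | hf', hfw'⟩
      · rcases hinc w hfw' with rfl | rfl
        exacts [absurd hw hu, absurd hw hv]
      · exact huniq f' ⟨hf', hfw'⟩
  · simp only [Finset.mem_insert, not_or] at hw
    rcases hf with rfl | hf
    · rcases hinc w hfw with h | h
      exacts [hw.1 h, hw.2.1 h]
    · exact hX' w hw.2.2 f hf hfw

lemma MatchesOn.isPerfectMatching [Fintype G.vertexSet] (h : G.MatchesOn N Finset.univ) :
    G.IsPerfectMatching N :=
  ⟨h.1, fun v hv => h.2.1 ⟨v, hv⟩ (Finset.mem_univ _)⟩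

lemma Matchable.exists_matchesOn [DecidableEq G.vertexSet]
    (h : Matchable (G.AdjAvoiding B) X) : ∃ N, Disjoint N B ∧ G.MatchesOn N X := by
  induction h with
  | empty => exact ⟨∅, by simp, by simp [MatchesOn]⟩
  | insert huv hne hu hv hX ih =>
    obtain ⟨N, hNB, hN⟩ := ih
    obtain ⟨e, he, heB⟩ := huv
    exact ⟨_, Set.disjoint_insert_left.2 ⟨heB, hNB⟩, hN.insert he hu hv⟩

/-- A perfect matching whose only edge in `B` is `e` matches, outside `B`, all vertices but the ends
of `e`. -/
lemma IsPerfectMatching.matchable [G.Loopless] [Fintype G.vertexSet] [DecidableEq G.vertexSet]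
    (hM : G.IsPerfectMatching M) {e : β} {u v : G.vertexSet} (heM : e ∈ M)
    (he : G.IsLink e u v) (hB : ∀ e' ∈ M, e' ∈ B → e' = e) :
    Matchable (G.AdjAvoiding B) ({u, v} : Finset G.vertexSet)ᶜ := by
  have hex : ∀ w : G.vertexSet, ∃ (e' : β) (w' : G.vertexSet), e' ∈ M ∧ G.IsLink e' w w' := by
    intro w
    obtain ⟨e', ⟨he', w', hw'⟩, -⟩ := hM.existsUnique_inc w w.2
    exact ⟨e', ⟨w', hw'.right_mem⟩, he', hw'⟩
  choose m σ hmM hlink using hex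
  have hm : ∀ w e', e' ∈ M → G.Inc e' w.1 → e' = m w := fun w e' he' hinc =>
    (hM.existsUnique_inc w w.2).unique ⟨he', hinc⟩ ⟨hmM w, (hlink w).inc_left⟩
  have hmσ : ∀ w, m (σ w) = m w := fun w => (hm (σ w) (m w) (hmM w) (hlink w).inc_right).symm
  have hend : ∀ w, m w = e ↔ w = u ∨ w = v := by
    intro w
    constructor
    · intro h
      have := hlink w
      rw [h] at this
      exact (this.inc_left.eq_or_eq_of_isLink he).imp Subtype.ext Subtype.ext
    · rintro (rfl | rfl)
      · exact (hm _ e heM he.inc_left).symm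
      · exact (hm _ e heM he.inc_right).symm
  have hcompl : ∀ w, w ∈ ({u, v} : Finset G.vertexSet)ᶜ ↔ m w ≠ e := by
    intro w
    rw [ne_eq, hend]
    simp
  refine Matchable.of_involution (σ := σ) fun w hw => ?_
  rw [hcompl] at hw
  refine ⟨by rwa [hcompl, hmσ], ⟨m w, hlink w, fun h => hw (hB _ (hmM w) h)⟩, ?_, ?_⟩
  · have h := hlink (σ w)
    rw [hmσ] at h
    exact Subtype.ext (h.right_unique (hlink w).symm)
  · intro h
    have := (hlink w).ne
    rw [h] at this
    exact this rfl

end PerfectMatching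

/-! ### Red halves in W-state graphs -/

namespace HalfEdgeColouring

variable {α β : Type*} {G : Graph α β} {c : G.HalfEdgeColouring} {e : β} {u v : α}

lemma IsWState.mem_bichromaticEdges (hW : c.IsWState) (h : G.Inc e v) (hred : c ⟨(e, v), h⟩ = 1) :
    e ∈ c.bichromaticEdges := by
  refine ⟨h.edge_mem, fun hm => ?_⟩
  have := hW.monochromaticAreBlue e hm v h
  rw [hred] at this
  exact absurd this (by decide)

lemma IsWState.eq_of_red (hW : c.IsWState) (hu : G.Inc e u) (hv : G.Inc e v)
    (hcu : c ⟨(e, u), hu⟩ = 1) (hcv : c ⟨(e, v), hv⟩ = 1) : u = v := by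
  by_contra hne
  refine (hW.mem_bichromaticEdges hu hcu).2 ⟨hu.edge_mem, fun x y hxy => ?_⟩
  have key : ∀ z (hz : G.Inc e z), c ⟨(e, z), hz⟩ = 1 := by
    intro z hz
    rcases hu.eq_or_eq_or_eq hv hz with h | rfl | rfl
    exacts [absurd h hne, hcu, hcv]
  rw [key, key]

end HalfEdgeColouring
end Graph

theorem mainTheorem2 {α β : Type*} (G : Graph α β) [G.Loopless]
    (hV : G.vertexSet.Finite) (hE : G.edgeSet.Finite)
    (c : G.HalfEdgeColouring) (hW : c.IsWState) :
    ¬ G.Simple ∧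
      ∃ (e f : β) (x y : α), e ≠ f ∧ G.IsLink e x y ∧ G.IsLink f x y := by
  classical
  suffices h : ∃ (e f : β) (x y : α), e ≠ f ∧ G.IsLink e x y ∧ G.IsLink f x y by
    refine ⟨fun hs => ?_, h⟩
    obtain ⟨e, f, x, y, hne, he, hf⟩ := h
    exact hne (he.eq hf)
  by_contra! hpar
  have : Fintype G.vertexSet := hV.fintype
  have hred : ∀ v : G.vertexSet, ∃ (e : β) (w : G.vertexSet) (h : G.IsLink e v w),
      c ⟨(e, v), h.inc_left⟩ = 1 := by
    intro v
    obtain ⟨e, ⟨w, h⟩, hc⟩ := hW.vertex_condition v v.2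
    exact ⟨e, ⟨w, h.right_mem⟩, h, hc⟩
  -- `r v` is an edge that is red at `v`, and `f v` is its other end.
  choose r f hlink hr using hred
  have hrB : ∀ v, r v ∈ c.bichromaticEdges := fun v => hW.mem_bichromaticEdges _ (hr v)
  have hrinj : ∀ u v, r u = r v → u = v := by
    intro u v h
    have hu := (hlink u).inc_left
    have hcu : c ⟨(r u, u), hu⟩ = 1 := hr u
    have hv : G.Inc (r u) v := h ▸ (hlink v).inc_left
    have hcv : c ⟨(r u, v), hv⟩ = 1 := by
      rw [← hr v]
      congr 3
    exact Subtype.ext (hW.eq_of_red hu hv hcu hcv)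
  have hone : ∀ M, G.IsPerfectMatching M → ∀ e ∈ M, ∀ e' ∈ M, e ∈ c.bichromaticEdges →
      e' ∈ c.bichromaticEdges → e = e' := by
    intro M hM e he e' he' hB hB'
    obtain ⟨x, hx⟩ := Set.ncard_eq_one.1 (hW.matching_condition M hM)
    have h1 : e ∈ M ∩ c.bichromaticEdges := ⟨he, hB⟩
    have h2 : e' ∈ M ∩ c.bichromaticEdges := ⟨he', hB'⟩
    rw [hx] at h1 h2
    exact h1.trans h2.symm
  have h0 : ¬ Graph.Matchable (G.AdjAvoiding c.bichromaticEdges) Finset.univ := by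
    intro h
    obtain ⟨N, hNB, hN⟩ := h.exists_matchesOn
    have := hW.matching_condition N hN.isPerfectMatching
    rw [hNB.inter_eq] at this
    simp at this
  have : Nonempty G.vertexSet := by
    by_contra hemp
    rw [not_nonempty_iff] at hemp
    apply h0
    rw [Finset.univ_eq_empty]
    exact .empty
  have hne : ∀ v, f v ≠ v := fun v h => (hlink v).ne (by rw [h])
  have hedge : ∀ p p', (f p = p' ∨ f p' = p) → ∃ e ∈ c.bichromaticEdges, G.IsLink e p p' := by
    rintro p p' (rfl | rfl)
    exacts [⟨r p, hrB p, hlink p⟩, ⟨r p', hrB p', (hlink p').symm⟩]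
  refine Graph.false_of_matchable (f := f) (adj := G.AdjAvoiding c.bichromaticEdges) ?_ ?_ hne ?_ h0 ?_ ?_
  · rintro u v ⟨e, he, heB⟩
    exact ⟨e, he.symm, heB⟩
  · rintro v ⟨e, he, -⟩
    exact he.ne rfl
  -- If `f (f v) = v`, then `r v` and `r (f v)` are parallel.
  · intro v h
    have h1 := hlink (f v)
    rw [h] at h1
    exact hpar (r v) (r (f v)) v (f v) (fun h => hne v (hrinj _ _ h).symm) (hlink v) h1.symm
  · intro v
    obtain ⟨M, hM, hrM⟩ := hW.matchingCovered (r v) (hrB v).1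
    exact hM.matchable hrM (hlink v) fun e' he' hB => hone M hM _ he' _ hrM hB (hrB v)
  -- Three disjoint bichromatic edges do not extend to a perfect matching.
  · intro p q s p' q' s' hp hq hs hnd h
    obtain ⟨e₁, hB₁, he₁⟩ := hedge _ _ hp
    obtain ⟨e₂, hB₂, he₂⟩ := hedge _ _ hq
    obtain ⟨e₃, -, he₃⟩ := hedge _ _ hs
    simp only [List.nodup_cons, List.mem_cons, List.not_mem_nil, or_false, not_or,
      not_false_eq_true, List.nodup_nil, and_true] at hnd
    obtain ⟨⟨n1, n2, n3, n4, n5⟩, ⟨n6, n7, n8, n9⟩, ⟨n10, n11, n12⟩, ⟨n13, n14⟩, n15⟩ := hnd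
    obtain ⟨N, -, hN⟩ := h.exists_matchesOn
    have hN' := ((hN.insert he₃ (by simp) (by simp)).insert he₂ (by simp [*]) (by
      simp [Ne.symm n11, n15])).insert he₁ (by simp [*]) (by
      simp [Ne.symm n10, Ne.symm n7, n13, n14])
    have huniv : (insert p (insert p' (insert q (insert q' (insert s (insert s'
        ({p, q, s, p', q', s'} : Finset G.vertexSet)ᶜ))))) : Finset G.vertexSet) =
          Finset.univ := by
      ext z
      simp only [Finset.mem_univ, Finset.mem_insert, Finset.mem_compl, Finset.mem_singleton]
      tauto
    rw [huniv] at hN'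
    have h12 := hone _ hN'.isPerfectMatching e₁ (by simp) e₂ (by simp) hB₁ hB₂
    subst h12
    rcases he₁.inc_left.eq_or_eq_of_isLink he₂ with h | h
    · exact n1 (Subtype.ext h)
    · exact n4 (Subtype.ext h)
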